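/- Let $E$ be a Dedekind complete real vector lattice. Let $\mathcal L_{\mathrm{ob}}(E)$ denote the space of order bounded linear operators on $E$, which is a vector lattice when $S\le T$ is taken to mean that $Sx\le Tx$ for all $x\ge 0$ in $E$, and let $\mathrm{Orth}(E)\subseteq\mathcal L_{\mathrm{ob}}(E)$ denote the vector sublattice of orthomorphisms, i.e. of the order bounded operators $T$ on $E$ such that $T(B)\subseteq B$ for every band $B$ in $E$. In a vector lattice $X$, a net $(x_\alpha)_{\alpha\in A}$ is said to be order convergent to $x\in X$, denoted by $x_\alpha\xrightarrow{\mathrm o}x$, when there is a net $(y_\beta)_{\beta\in B}$ in $X$ (with a possibly different index set) such that $y_\beta\downarrow 0$ and such that, for every $\beta_0\in B$, there is an $\alpha_0\in A$ with $|x-x_\alpha|\le y_{\beta_0}$ for all $\alpha\ge\alpha_0$. Let $(T_n)$ be a sequence in $\mathrm{Orth}(E)$; it is not assumed to be order bounded. Let $S$ be a non-empty subset of $E$ such that the (order) ideal $I_S$ of $E$ that is generated by $S$ equals $E$. Then the following are equivalent: 1. $T_n\xrightarrow{\mathrm o}0$ in $\mathrm{Orth}(E)$; 2. $T_n\xrightarrow{\mathrm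 o}0$ in $\mathcal L_{\mathrm{ob}}(E)$; 3. $T_n s\xrightarrow{\mathrm o}0$ in $E$ for all $s\in S$; 4. $T_n x\xrightarrow{\mathrm o}0$ in $E$ for all $x\in E$. In particular, when $E$ has a strong order unit $e$ (i.e. $e\ge 0$ and for every $x\in E$ there is a real $\lambda\ge 0$ with $|x|\le\lambda e$), then $T_n\xrightarrow{\mathrm o}0$ in $\mathrm{Orth}(E)$ if and only if $T_n e\xrightarrow{\mathrm o}0$ in $E$. -/

import Mathlib

/-!
Vector lattices are real. Throughout, a vector lattice is given by the instances
`[AddCommGroup E] [Lattice E] [IsOrderedAddMonoid E] [Module ℝ E] [IsOrderedModule ℝ E]`; it is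
Dedekind complete (hence Archimedean) when `Lattice E` is replaced by
`ConditionallyCompleteLattice E`.
-/

universe u v w

namespace VectorLattice

section OrderConvergence

/-- Order convergence of a net `x`, indexed by `A`, to `l`: there is a net `y`, indexed by a
possibly different directed set `B`, with `y ↓ 0`, such that for every `b` eventually
`|l - x a| ≤ y b`. -/
def OrderTendsto {X : Type u} [AddCommGroup X] [Lattice X] {A : Type v} [Preorder A]
    (x : A → X) (l : X) : Prop :=
  ∃ (B : Type u) (_ : Preorder B) (_ : IsDirectedOrder B) (_ : Nonempty B) (y : B → X),
    Antitone y ∧ IsGLB (Set.range y) 0 ∧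
      ∀ b₀ : B, ∃ a₀ : A, ∀ a : A, a₀ ≤ a → |l - x a| ≤ y b₀

end OrderConvergence

section Ideals

variable {E : Type u} [AddCommGroup E] [Lattice E] [Module ℝ E]

/-- An (order) ideal: a solid linear subspace. -/
def IsIdeal (I : Submodule ℝ E) : Prop :=
  ∀ x y : E, |x| ≤ |y| → y ∈ I → x ∈ I

/-- A band: an ideal that contains the supremum of each of its non-empty subsets whose supremum
exists in the vector lattice. -/
def IsBand (B : Submodule ℝ E) : Prop :=
  IsIdeal B ∧ ∀ (A : Set E) (x : E), A ⊆ B → A.Nonempty → IsLUB A x → x ∈ B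

/-- The ideal `I_S` that is generated by `S`. -/
def idealSpan (S : Set E) : Submodule ℝ E :=
  sInf {I : Submodule ℝ E | IsIdeal I ∧ S ⊆ I}

/-- `e` is a strong order unit. -/
def IsStrongOrderUnit (e : E) : Prop :=
  0 ≤ e ∧ ∀ x : E, ∃ c : ℝ, 0 ≤ c ∧ |x| ≤ c • e

end Ideals

section Operators

variable (E : Type u) (F : Type v)
  [AddCommGroup E] [Lattice E] [Module ℝ E]
  [AddCommGroup F] [Lattice F] [IsOrderedAddMonoid F] [Module ℝ F] [IsOrderedModule ℝ F]

/-- The space of order bounded operators from `E` into `F`: the linear maps that map order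
bounded sets to order bounded sets. -/
def Lob : Submodule ℝ (E →ₗ[ℝ] F) where
  carrier := {T | ∀ A : Set E, BddAbove A → BddBelow A → BddAbove (T '' A) ∧ BddBelow (T '' A)}
  zero_mem' := by
    intro A _ _
    refine ⟨⟨0, ?_⟩, ⟨0, ?_⟩⟩ <;> rintro _ ⟨x, _, rfl⟩ <;> simp
  add_mem' := by
    intro S T hS hT A h₁ h₂
    obtain ⟨⟨a, ha⟩, ⟨b, hb⟩⟩ := hS A h₁ h₂
    obtain ⟨⟨c, hc⟩, ⟨d, hd⟩⟩ := hT A h₁ h₂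
    refine ⟨⟨a + c, ?_⟩, ⟨b + d, ?_⟩⟩ <;> rintro _ ⟨x, hx, rfl⟩
    · exact add_le_add (ha ⟨x, hx, rfl⟩) (hc ⟨x, hx, rfl⟩)
    · exact add_le_add (hb ⟨x, hx, rfl⟩) (hd ⟨x, hx, rfl⟩)
  smul_mem' := by
    intro r T hT A h₁ h₂
    obtain ⟨⟨a, ha⟩, ⟨b, hb⟩⟩ := hT A h₁ h₂
    rcases le_total 0 r with hr | hr
    · refine ⟨⟨r • a, ?_⟩, ⟨r • b, ?_⟩⟩ <;> rintro _ ⟨x, hx, rfl⟩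
      · exact smul_le_smul_of_nonneg_left (ha ⟨x, hx, rfl⟩) hr
      · exact smul_le_smul_of_nonneg_left (hb ⟨x, hx, rfl⟩) hr
    · refine ⟨⟨r • b, ?_⟩, ⟨r • a, ?_⟩⟩ <;> rintro _ ⟨x, hx, rfl⟩
      · exact smul_le_smul_of_nonpos_left (hb ⟨x, hx, rfl⟩) hr
      · exact smul_le_smul_of_nonpos_left (ha ⟨x, hx, rfl⟩) hr

end Operators

section OperatorOrder

variable {E : Type u} {F : Type v}
  [AddCommGroup E] [Lattice E] [IsOrderedAddMonoid E] [Module ℝ E]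
  [AddCommGroup F] [Lattice F] [IsOrderedAddMonoid F] [Module ℝ F] [IsOrderedModule ℝ F]

/-- The operator order: `S ≤ T` when `S x ≤ T x` for all `x ≥ 0`. -/
instance instPartialOrderLob : PartialOrder (Lob E F) where
  le S T := ∀ x : E, 0 ≤ x → S.1 x ≤ T.1 x
  le_refl _ _ _ := le_rfl
  le_trans _ _ _ h₁ h₂ x hx := (h₁ x hx).trans (h₂ x hx)
  le_antisymm S T h₁ h₂ := by
    have h : ∀ x : E, 0 ≤ x → S.1 x = T.1 x := fun x hx => le_antisymm (h₁ x hx) (h₂ x hx)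
    apply Subtype.ext
    apply LinearMap.ext
    intro x
    rw [← posPart_sub_negPart x, map_sub, map_sub, h _ (posPart_nonneg x), h _ (negPart_nonneg x)]

theorem Lob.le_def (S T : Lob E F) : S ≤ T ↔ ∀ x : E, 0 ≤ x → S.1 x ≤ T.1 x := Iff.rfl

instance instIsOrderedAddMonoidLob : IsOrderedAddMonoid (Lob E F) where
  add_le_add_left _ _ h _ := fun x hx => by
    simpa using h x hx

instance instIsOrderedModuleLob : IsOrderedModule ℝ (Lob E F) where
  smul_le_smul_of_nonneg_left _ hr _ _ h := fun x hx =>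
    smul_le_smul_of_nonneg_left (h x hx) hr
  smul_le_smul_of_nonneg_right S hS _ _ hrt := fun x hx =>
    smul_le_smul_of_nonneg_right hrt (show (0 : F) ≤ S.1 x from hS x hx)

end OperatorOrder

section RieszKantorovich

/-- A partially ordered abelian group in which positive parts exist is a lattice, with the given
order. -/
noncomputable abbrev latticeOfPosPart {X : Type u} [AddCommGroup X] [PartialOrder X]
    [IsOrderedAddMonoid X] (h : ∀ x : X, ∃ p, IsLUB {x, 0} p) : Lattice X where
  sup a b := b + (h (a - b)).choose
  inf a b := a - (h (a - b)).choose
  le_sup_left a b := by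
    have := (h (a - b)).choose_spec.1 (Set.mem_insert _ _)
    exact sub_le_iff_le_add'.1 this
  le_sup_right a b := by
    have := (h (a - b)).choose_spec.1 (Set.mem_insert_of_mem _ rfl)
    exact le_add_of_nonneg_right this
  sup_le a b c hac hbc := by
    have : (h (a - b)).choose ≤ c - b := by
      refine (h (a - b)).choose_spec.2 ?_
      rintro _ (rfl | rfl)
      · exact sub_le_sub_right hac b
      · exact sub_nonneg.2 hbc
    exact le_sub_iff_add_le'.1 this
  inf_le_left a b := by
    have := (h (a - b)).choose_spec.1 (Set.mem_insert_of_mem _ rfl)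
    exact sub_le_self a this
  inf_le_right a b := by
    have := (h (a - b)).choose_spec.1 (Set.mem_insert _ _)
    exact sub_le_comm.1 this
  le_inf a b c hab hac := by
    have : (h (b - c)).choose ≤ b - a := by
      refine (h (b - c)).choose_spec.2 ?_
      rintro _ (rfl | rfl)
      · exact sub_le_sub_left hac b
      · exact sub_nonneg.2 hab
    exact le_sub_comm.1 this

variable {E : Type u} {F : Type v}
  [AddCommGroup E] [Lattice E] [IsOrderedAddMonoid E] [Module ℝ E] [IsOrderedModule ℝ E]
  [AddCommGroup F] [ConditionallyCompleteLattice F] [IsOrderedAddMonoid F] [Module ℝ F]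
  [IsOrderedModule ℝ F]

/-- An additive and positively homogeneous map on the positive cone extends to a linear map. -/
theorem exists_linear_extension (p : E → F)
    (hadd : ∀ x y, 0 ≤ x → 0 ≤ y → p (x + y) = p x + p y)
    (hsmul : ∀ (c : ℝ) x, 0 < c → 0 ≤ x → p (c • x) = c • p x) :
    ∃ P : E →ₗ[ℝ] F, ∀ x, 0 ≤ x → P x = p x := by
  have h0 : p 0 = 0 := by
    have := hadd 0 0 le_rfl le_rfl
    simpa using this
  have key : ∀ x a b : E, 0 ≤ a → 0 ≤ b → x = a - b → p (x⁺) - p (x⁻) = p a - p b := by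
    intro x a b ha hb hx
    have h1 : x⁺ + b = a + x⁻ := by
      have := posPart_sub_negPart x
      rw [hx] at this ⊢
      rw [sub_eq_sub_iff_add_eq_add] at this
      exact this
    have h2 := congrArg p h1
    rw [hadd _ _ (posPart_nonneg x) hb, hadd _ _ ha (negPart_nonneg x)] at h2
    rw [sub_eq_sub_iff_add_eq_add]
    exact h2
  have dec : ∀ x : E, x = x⁺ - x⁻ := fun x => (posPart_sub_negPart x).symm
  refine ⟨{ toFun := fun x => p (x⁺) - p (x⁻), map_add' := ?_, map_smul' := ?_ }, ?_⟩
  · intro x y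
    rw [key (x + y) (x⁺ + y⁺) (x⁻ + y⁻) (add_nonneg (posPart_nonneg x) (posPart_nonneg y))
      (add_nonneg (negPart_nonneg x) (negPart_nonneg y))
      (by rw [add_sub_add_comm, ← dec, ← dec]),
      hadd _ _ (posPart_nonneg x) (posPart_nonneg y),
      hadd _ _ (negPart_nonneg x) (negPart_nonneg y), add_sub_add_comm]
  · intro c x
    rw [RingHom.id_apply]
    rcases lt_trichotomy c 0 with hc | rfl | hc
    · have hc' : 0 < -c := neg_pos.2 hc
      rw [key (c • x) ((-c) • x⁻) ((-c) • x⁺) (smul_nonneg hc'.le (negPart_nonneg x))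
        (smul_nonneg hc'.le (posPart_nonneg x))
        (by
          conv_lhs => rw [dec x]
          rw [← smul_sub, neg_smul, ← smul_neg, neg_sub]),
        hsmul _ _ hc' (negPart_nonneg x), hsmul _ _ hc' (posPart_nonneg x), ← smul_sub, neg_smul,
        ← smul_neg, neg_sub]
    · simp
    · rw [key (c • x) (c • x⁺) (c • x⁻) (smul_nonneg hc.le (posPart_nonneg x))
        (smul_nonneg hc.le (negPart_nonneg x)) (by rw [← smul_sub, ← dec]),
        hsmul _ _ hc (posPart_nonneg x), hsmul _ _ hc (negPart_nonneg x), smul_sub]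
  · intro x hx
    simp [posPart_of_nonneg hx, negPart_of_nonneg hx, h0]

/-- The Riesz–Kantorovich formula: `T` has a positive part `P` in the order bounded operators, and
`P x = sup {T y : 0 ≤ y ≤ x}` for `x ≥ 0`. -/
theorem exists_posPart_Lob (T : Lob E F) :
    ∃ P : Lob E F, IsLUB {T, 0} P ∧ ∀ x, 0 ≤ x → IsLUB (T.1 '' Set.Icc 0 x) (P.1 x) := by
  set p : E → F := fun x => sSup (T.1 '' Set.Icc 0 x) with hp
  have hlub : ∀ x, 0 ≤ x → IsLUB (T.1 '' Set.Icc 0 x) (p x) := fun x hx =>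
    isLUB_csSup ((Set.nonempty_Icc.2 hx).image _) (T.2 _ bddAbove_Icc bddBelow_Icc).1
  have hmem : ∀ x y, 0 ≤ y → y ≤ x → T.1 y ≤ p x := fun x y hy hyx =>
    (hlub x (hy.trans hyx)).1 ⟨y, ⟨hy, hyx⟩, rfl⟩
  have hle : ∀ x c, 0 ≤ x → (∀ y, 0 ≤ y → y ≤ x → T.1 y ≤ c) → p x ≤ c := by
    intro x c hx h
    refine (hlub x hx).2 ?_
    rintro _ ⟨y, hy, rfl⟩
    exact h y hy.1 hy.2
  have hadd : ∀ x y, 0 ≤ x → 0 ≤ y → p (x + y) = p x + p y := by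
    intro x y hx hy
    apply le_antisymm
    · refine hle _ _ (add_nonneg hx hy) fun z hz hzxy => ?_
      have h1 : T.1 z = T.1 (z ⊓ x) + T.1 (z - z ⊓ x) := by rw [← map_add]; simp
      rw [h1]
      refine add_le_add (hmem _ _ (le_inf hz hx) inf_le_right)
        (hmem _ _ (sub_nonneg.2 inf_le_left) ?_)
      rw [sub_le_iff_le_add', ← sub_le_iff_le_add]
      refine le_inf (sub_le_self z hy) (sub_le_iff_le_add.2 hzxy)
    · rw [← le_sub_iff_add_le]
      refine hle _ _ hx fun a ha hax => ?_
      rw [le_sub_comm]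
      refine hle _ _ hy fun b hb hby => ?_
      rw [le_sub_iff_add_le', ← map_add]
      exact hmem _ _ (add_nonneg ha hb) (add_le_add hax hby)
  have hsmul_le : ∀ (c : ℝ) x, 0 < c → 0 ≤ x → p (c • x) ≤ c • p x := by
    intro c x hc hx
    refine hle _ _ (smul_nonneg hc.le hx) fun y hy hyx => ?_
    have h1 : T.1 y = c • T.1 (c⁻¹ • y) := by rw [← map_smul, smul_inv_smul₀ hc.ne']
    rw [h1]
    refine smul_le_smul_of_nonneg_left (hmem _ _ (smul_nonneg (inv_pos.2 hc).le hy) ?_) hc.le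
    have := smul_le_smul_of_nonneg_left hyx (inv_pos.2 hc).le
    rwa [inv_smul_smul₀ hc.ne'] at this
  have hsmul : ∀ (c : ℝ) x, 0 < c → 0 ≤ x → p (c • x) = c • p x := by
    intro c x hc hx
    apply le_antisymm (hsmul_le c x hc hx)
    have h1 := hsmul_le c⁻¹ (c • x) (inv_pos.2 hc) (smul_nonneg hc.le hx)
    rw [inv_smul_smul₀ hc.ne'] at h1
    have := smul_le_smul_of_nonneg_left h1 hc.le
    rwa [smul_inv_smul₀ hc.ne'] at this
  obtain ⟨P, hP⟩ := exists_linear_extension p hadd hsmul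
  have hPpos : ∀ x, 0 ≤ x → 0 ≤ P x := fun x hx => by
    rw [hP x hx]
    have := hmem x 0 le_rfl hx
    rwa [map_zero] at this
  have hPmono : ∀ x y, x ≤ y → P x ≤ P y := fun x y hxy => by
    have := hPpos (y - x) (sub_nonneg.2 hxy)
    rwa [map_sub, sub_nonneg] at this
  have hPob : P ∈ Lob E F := by
    rintro A ⟨a, ha⟩ ⟨b, hb⟩
    refine ⟨⟨P a, ?_⟩, ⟨P b, ?_⟩⟩ <;> rintro _ ⟨x, hx, rfl⟩
    · exact hPmono _ _ (ha hx)
    · exact hPmono _ _ (hb hx)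
  refine ⟨⟨P, hPob⟩, ⟨?_, ?_⟩, ?_⟩
  · rintro R (rfl | rfl) x hx
    · change R.1 x ≤ P x
      rw [hP x hx]
      exact hmem x x hx le_rfl
    · exact hPpos x hx
  · intro R hR x hx
    change P x ≤ R.1 x
    rw [hP x hx]
    have hR0 : (0 : Lob E F) ≤ R := hR (Set.mem_insert_of_mem _ rfl)
    have hRT : T ≤ R := hR (Set.mem_insert _ _)
    refine hle _ _ hx fun y hy hyx => (hRT y hy).trans ?_
    have : (0 : F) ≤ R.1 (x - y) := hR0 (x - y) (sub_nonneg.2 hyx)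
    rw [map_sub] at this
    exact sub_nonneg.1 this
  · intro x hx
    change IsLUB _ (P x)
    rw [hP x hx]
    exact hlub x hx

/-- For Dedekind complete `F`, the order bounded operators from `E` into `F` form a vector lattice
in the operator order. -/
noncomputable instance instLatticeLob : Lattice (Lob E F) :=
  latticeOfPosPart (X := Lob E F) fun T => (exists_posPart_Lob T).imp fun _ h => h.1

end RieszKantorovich

section Orthomorphisms

variable (E : Type u)

/-- The orthomorphisms on `E`: the order bounded operators that map every band into itself. As a
subspace of `Lob E E`, it carries the operator order. -/
def Orth [AddCommGroup E] [Lattice E] [IsOrderedAddMonoid E] [Module ℝ E] [IsOrderedModule ℝ E] :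
    Submodule ℝ (Lob E E) where
  carrier := {T | ∀ B : Submodule ℝ E, IsBand B → ∀ x ∈ B, T.1 x ∈ B}
  zero_mem' := fun B _ _ _ => B.zero_mem
  add_mem' := fun hS hT B hB x hx => B.add_mem (hS B hB x hx) (hT B hB x hx)
  smul_mem' := fun r _ hT B hB x hx => B.smul_mem r (hT B hB x hx)

variable {E}

section

variable [AddCommGroup E] [Lattice E] [IsOrderedAddMonoid E] [Module ℝ E] [IsOrderedModule ℝ E]

/-- The order on the orthomorphisms is the operator order. -/
instance instPartialOrderOrth : PartialOrder (Orth E) :=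
  PartialOrder.lift (fun T : Orth E => (T : Lob E E)) Subtype.val_injective

theorem Orth.le_def (S T : Orth E) : S ≤ T ↔ (S : Lob E E) ≤ (T : Lob E E) := Iff.rfl

instance instIsOrderedAddMonoidOrth : IsOrderedAddMonoid (Orth E) where
  add_le_add_left _ _ h R := by
    rw [Orth.le_def] at h ⊢
    exact add_le_add_left h (R : Lob E E)

instance instIsOrderedModuleOrth : IsOrderedModule ℝ (Orth E) where
  smul_le_smul_of_nonneg_left _ hr _ _ h := by
    rw [Orth.le_def] at h ⊢
    exact smul_le_smul_of_nonneg_left h hr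
  smul_le_smul_of_nonneg_right _ hS _ _ hrt := by
    rw [Orth.le_def] at hS ⊢
    exact smul_le_smul_of_nonneg_right hrt hS

end

variable [AddCommGroup E] [ConditionallyCompleteLattice E] [IsOrderedAddMonoid E] [Module ℝ E]
  [IsOrderedModule ℝ E]

theorem exists_posPart_Orth (T : Orth E) : ∃ P : Orth E, IsLUB {T, 0} P := by
  obtain ⟨P, hP, hf⟩ := exists_posPart_Lob T.1
  have hpos : ∀ B : Submodule ℝ E, IsBand B → ∀ x ∈ B, 0 ≤ x → P.1 x ∈ B := by
    intro B hB x hx h0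
    refine hB.2 _ _ ?_ ((Set.nonempty_Icc.2 h0).image _) (hf x h0)
    rintro _ ⟨y, hy, rfl⟩
    refine T.2 B hB y (hB.1 y x ?_ hx)
    rw [abs_of_nonneg hy.1, abs_of_nonneg h0]
    exact hy.2
  have hPO : P ∈ Orth E := by
    intro B hB x hx
    rw [← posPart_sub_negPart x, map_sub]
    refine B.sub_mem (hpos B hB _ (hB.1 _ x ?_ hx) (posPart_nonneg x))
      (hpos B hB _ (hB.1 _ x ?_ hx) (negPart_nonneg x))
    · rw [abs_of_nonneg (posPart_nonneg x)]
      exact sup_le (le_abs_self x) (abs_nonneg x)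
    · rw [abs_of_nonneg (negPart_nonneg x)]
      exact sup_le (neg_le_abs x) (abs_nonneg x)
  have hTP : T.1 ≤ P := hP.1 (Set.mem_insert _ _)
  have h0P : (0 : Lob E E) ≤ P := hP.1 (Set.mem_insert_of_mem _ rfl)
  refine ⟨⟨P, hPO⟩, ?_, ?_⟩
  · intro R hR
    rcases hR with hR | hR
    · rw [hR]
      exact hTP
    · rw [Set.mem_singleton_iff.1 hR]
      exact h0P
  · intro R hR
    have hTR : T.1 ≤ R.1 := hR (Set.mem_insert _ _)
    have h0R : (0 : Lob E E) ≤ R.1 := hR (Set.mem_insert_of_mem _ rfl)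
    have hPR : P ≤ R.1 := hP.2 (by
      intro Q hQ
      rcases hQ with hQ | hQ
      · rw [hQ]
        exact hTR
      · rw [Set.mem_singleton_iff.1 hQ]
        exact h0R)
    exact hPR

/-- The orthomorphisms form a vector lattice in the operator order. -/
noncomputable instance instLatticeOrth : Lattice (Orth E) :=
  latticeOfPosPart (X := Orth E) exists_posPart_Orth

end Orthomorphisms

end VectorLattice

namespace VectorLattice

/-! ### Disjoint complements are bands -/

section DisjointComplement

variable {E : Type*} [AddCommGroup E] [Lattice E] [IsOrderedAddMonoid E]

/-! Disjoint complements are bands, so orthomorphisms preserve disjointness. From this, `T⁺ x` and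
`T⁻ x` are disjoint for `x ≥ 0`, and hence `|T| x = |T x|` (`Orth.abs_apply`); the modulus is the
same in `Orth E` and in `Lob E E` (`Orth.coe_abs`).

For 1 → 2, the orthomorphisms are an ideal in the order bounded operators, so an infimum 0 taken in
`Orth E` remains an infimum in `Lob E E`. For 2 → 3, infima of decreasing nets of operators are
pointwise (`isGLB_apply`). For 3 → 4, the `x` with `T n x → 0` form an ideal, because `|T x|` and
`|T| |x|` dominate each other up to a factor 2.

The main step is 4 → 1. Pointwise order convergence of a sequence makes it pointwise order bounded,
so `Y m x = sup {|T n x| : n ≥ m}` exists for `x ≥ 0`. This supremum is additive in `x`, because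
finite suprema of orthomorphisms are pointwise; thus `Y m` is an orthomorphism. The `Y m` decrease
to 0 since they do so at every point, and they dominate the tails of `T`. -/

theorem add_inf_le_inf_add_inf {a b u : E} (ha : 0 ≤ a) (hb : 0 ≤ b) (hu : 0 ≤ u) :
    (a + b) ⊓ u ≤ a ⊓ u + b ⊓ u := by
  have h : (a + b) ⊓ u - a ⊓ u ≤ b ⊓ u := by
    refine le_inf ?_ ?_
    · rw [sub_le_comm]
      refine le_inf (sub_le_iff_le_add.2 inf_le_left) ?_
      exact (sub_le_self _ hb).trans inf_le_right
    · exact (sub_le_self _ (le_inf ha hu)).trans inf_le_right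
  rwa [sub_le_iff_le_add'] at h

/-- Meeting the triangle inequality `|a| ≤ |a - b| + |b|` with `|a|` removes the term `|b|`, which
is disjoint from `|a|`. -/
theorem abs_le_abs_sub_of_inf_eq_zero {a b : E} (h : |a| ⊓ |b| = 0) : |a| ≤ |a - b| := by
  have h1 : |a| ≤ |a - b| + |b| := by
    have := abs_add_le (a - b) b
    rwa [sub_add_cancel] at this
  calc |a| = (|a - b| + |b|) ⊓ |a| := (inf_eq_right.2 h1).symm
    _ ≤ |a - b| ⊓ |a| + |b| ⊓ |a| :=
      add_inf_le_inf_add_inf (abs_nonneg _) (abs_nonneg _) (abs_nonneg _)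
    _ = |a - b| ⊓ |a| := by rw [inf_comm |b|, h, add_zero]
    _ ≤ |a - b| := inf_le_left

variable [Module ℝ E] [IsOrderedModule ℝ E]

/-- Replacing a real scalar by a natural number reduces closure under scalars to closure under sums,
for disjoint complements and for null sequences alike. -/
theorem abs_smul_le_nsmul {c : ℝ} {k : ℕ} (hk : |c| ≤ k) (x : E) : |c • x| ≤ k • |x| := by
  have hc := abs_le.1 hk
  have h0 : ∀ y : E, 0 ≤ y → c • y ≤ k • y ∧ -(k • y) ≤ c • y := fun y hy => by
    rw [← Nat.cast_smul_eq_nsmul ℝ, ← neg_smul]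
    exact ⟨smul_le_smul_of_nonneg_right hc.2 hy, smul_le_smul_of_nonneg_right hc.1 hy⟩
  have hp := h0 _ (posPart_nonneg x)
  have hn := h0 _ (negPart_nonneg x)
  have hx : c • x = c • x⁺ - c • x⁻ := by rw [← smul_sub, posPart_sub_negPart]
  rw [← posPart_add_negPart x, hx, smul_add]
  refine abs_le'.2 ⟨?_, ?_⟩
  · rw [sub_eq_add_neg]
    exact add_le_add hp.1 (neg_le.1 hn.2)
  · rw [neg_sub, sub_eq_neg_add]
    exact add_le_add (neg_le.1 hp.2) hn.1

/-- The disjoint complement of an element. -/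
def disjointComplement (u : E) : Submodule ℝ E where
  carrier := {x | |x| ⊓ |u| = 0}
  zero_mem' := by simp
  add_mem' := by
    intro x y hx hy
    refine le_antisymm ?_ (le_inf (abs_nonneg _) (abs_nonneg _))
    calc |x + y| ⊓ |u| ≤ (|x| + |y|) ⊓ |u| := inf_le_inf_right _ (abs_add_le x y)
      _ ≤ |x| ⊓ |u| + |y| ⊓ |u| :=
        add_inf_le_inf_add_inf (abs_nonneg _) (abs_nonneg _) (abs_nonneg _)
      _ = 0 := by rw [hx, hy, add_zero]
  smul_mem' := by
    intro c x hx
    obtain ⟨k, hk⟩ := exists_nat_ge |c|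
    have h : ∀ k : ℕ, (k • |x|) ⊓ |u| ≤ 0 := by
      intro k
      induction k with
      | zero => simp
      | succ k ih =>
        rw [succ_nsmul]
        refine (add_inf_le_inf_add_inf (nsmul_nonneg (abs_nonneg _) k) (abs_nonneg _)
          (abs_nonneg _)).trans ?_
        rw [hx, add_zero]
        exact ih
    exact le_antisymm ((inf_le_inf_right _ (abs_smul_le_nsmul hk x)).trans (h k))
      (le_inf (abs_nonneg _) (abs_nonneg _))

theorem mem_disjointComplement {u x : E} : x ∈ disjointComplement u ↔ |x| ⊓ |u| = 0 := Iff.rfl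

theorem isIdeal_disjointComplement (u : E) : IsIdeal (disjointComplement u) := by
  intro x y hxy hy
  rw [mem_disjointComplement] at hy ⊢
  exact le_antisymm ((inf_le_inf_right _ hxy).trans hy.le)
    (le_inf (abs_nonneg _) (abs_nonneg _))

omit [IsOrderedModule ℝ E] in
theorem IsIdeal.posPart_mem {I : Submodule ℝ E} (hI : IsIdeal I) {x : E} (hx : x ∈ I) :
    x⁺ ∈ I := by
  refine hI _ x ?_ hx
  rw [abs_of_nonneg (posPart_nonneg x)]
  exact sup_le (le_abs_self x) (abs_nonneg x)

omit [IsOrderedModule ℝ E] in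
theorem IsIdeal.negPart_mem {I : Submodule ℝ E} (hI : IsIdeal I) {x : E} (hx : x ∈ I) :
    x⁻ ∈ I := by
  refine hI _ x ?_ hx
  rw [abs_of_nonneg (negPart_nonneg x)]
  exact sup_le (neg_le_abs x) (abs_nonneg x)

theorem isBand_disjointComplement (u : E) : IsBand (disjointComplement u) := by
  refine ⟨isIdeal_disjointComplement u, ?_⟩
  intro A x hA hne hx
  have hI := isIdeal_disjointComplement u
  obtain ⟨a₀, ha₀⟩ := hne
  have hneg : x⁻ ∈ disjointComplement u := by
    refine hI _ a₀⁻ ?_ (hI.negPart_mem (hA ha₀))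
    rw [abs_of_nonneg (negPart_nonneg _), abs_of_nonneg (negPart_nonneg _)]
    exact negPart_anti (hx.1 ha₀)
  have hc0 : 0 ≤ x⁺ ⊓ |u| := le_inf (posPart_nonneg _) (abs_nonneg _)
  have hc : x⁺ ⊓ |u| ≤ 0 := by
    -- Adding `x⁻` shifts `A` below `x⁺`. Then `(a + x⁻)⁺` and `x⁺ ⊓ |u|` are disjoint and both
    -- below `x⁺`, so their sum, being their supremum, is below `x⁺` too. Hence `x - x⁺ ⊓ |u|` is
    -- still an upper bound of `A`.
    have hub : x ≤ x - x⁺ ⊓ |u| := by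
      refine hx.2 fun a ha => ?_
      have hmem : (a + x⁻)⁺ ∈ disjointComplement u :=
        hI.posPart_mem ((disjointComplement u).add_mem (hA ha) hneg)
      have hle : (a + x⁻)⁺ ≤ x⁺ := by
        refine sup_le ?_ (posPart_nonneg x)
        have := add_le_add_left (hx.1 ha) x⁻
        rwa [← sub_eq_iff_eq_add.1 (posPart_sub_negPart x)] at this
      have hdisj : (a + x⁻)⁺ ⊓ (x⁺ ⊓ |u|) = 0 := by
        refine le_antisymm ?_ (le_inf (posPart_nonneg _) hc0)
        rw [mem_disjointComplement, abs_of_nonneg (posPart_nonneg _)] at hmem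
        rw [← hmem]
        exact inf_le_inf_left _ inf_le_right
      have hsum : (a + x⁻)⁺ + x⁺ ⊓ |u| ≤ x⁺ := by
        rw [← inf_add_sup, hdisj, zero_add]
        exact sup_le hle inf_le_left
      have h2 := (add_le_add_left (le_posPart (a + x⁻)) (x⁺ ⊓ |u|)).trans hsum
      have hx' : x - x⁺ ⊓ |u| = x⁺ - x⁻ - x⁺ ⊓ |u| := by rw [posPart_sub_negPart]
      rw [hx', le_sub_iff_add_le, le_sub_iff_add_le]
      rwa [add_right_comm] at h2
    have := le_sub_self_iff x |>.1 hub
    exact this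
  have hpos : x⁺ ∈ disjointComplement u := by
    rw [mem_disjointComplement, abs_of_nonneg (posPart_nonneg _)]
    exact le_antisymm hc hc0
  rw [← posPart_sub_negPart x]
  exact (disjointComplement u).sub_mem hpos hneg

theorem Orth.disjoint_apply (T : Orth E) {x u : E} (h : |x| ⊓ |u| = 0) :
    |T.1.1 x| ⊓ |u| = 0 :=
  T.2 _ (isBand_disjointComplement u) x h

theorem Orth.disjoint_apply_apply (S T : Orth E) {x u : E} (h : |x| ⊓ |u| = 0) :
    |S.1.1 x| ⊓ |T.1.1 u| = 0 := by
  rw [inf_comm]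
  apply Orth.disjoint_apply
  rw [inf_comm]
  exact Orth.disjoint_apply S h

/-- An operator that maps the positive elements of bands into these bands is an
orthomorphism. -/
theorem mem_Orth_of_nonneg (P : Lob E E)
    (h : ∀ B : Submodule ℝ E, IsBand B → ∀ x ∈ B, 0 ≤ x → P.1 x ∈ B) : P ∈ Orth E := by
  intro B hB x hx
  rw [← posPart_sub_negPart x, map_sub]
  exact B.sub_mem (h B hB _ (hB.1.posPart_mem hx) (posPart_nonneg x))
    (h B hB _ (hB.1.negPart_mem hx) (negPart_nonneg x))

/-- The orthomorphisms form an ideal in the order bounded operators. -/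
theorem mem_Orth_of_abs_le (P : Lob E E) (R : Orth E)
    (h : ∀ x, 0 ≤ x → |P.1 x| ≤ |R.1.1 x|) : P ∈ Orth E :=
  mem_Orth_of_nonneg P fun B hB x hx hx0 => hB.1 _ _ (h x hx0) (R.2 B hB x hx)

theorem mem_Lob_of_nonneg (P : E →ₗ[ℝ] E) (h : ∀ x, 0 ≤ x → 0 ≤ P x) : P ∈ Lob E E := by
  have hmono : ∀ x y, x ≤ y → P x ≤ P y := fun x y hxy => by
    have := h (y - x) (sub_nonneg.2 hxy)
    rwa [map_sub, sub_nonneg] at this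
  rintro A ⟨a, ha⟩ ⟨b, hb⟩
  refine ⟨⟨P a, ?_⟩, ⟨P b, ?_⟩⟩ <;> rintro _ ⟨x, hx, rfl⟩
  · exact hmono _ _ (ha hx)
  · exact hmono _ _ (hb hx)

theorem apply_le_apply_of_nonneg {P : Lob E E} (h : 0 ≤ P) {x y : E} (hxy : x ≤ y) :
    P.1 x ≤ P.1 y := by
  have : (0 : E) ≤ P.1 (y - x) := h (y - x) (sub_nonneg.2 hxy)
  rwa [map_sub, sub_nonneg] at this

end DisjointComplement

/-! ### The modulus of an orthomorphism is pointwise -/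

section Modulus

variable {E : Type*} [AddCommGroup E] [ConditionallyCompleteLattice E] [IsOrderedAddMonoid E]
  [Module ℝ E] [IsOrderedModule ℝ E]

/-- For positive orthomorphisms `P` and `Q`, the elements `2 (P y + Q (x - y))`, with
`0 ≤ y ≤ x`, are bounded below by `P x ⊓ Q x`. -/
theorem Orth.inf_apply_le (P Q : Orth E) (hP : 0 ≤ P) (hQ : 0 ≤ Q) {x y : E}
    (hy : 0 ≤ y) (hyx : y ≤ x) :
    P.1.1 x ⊓ Q.1.1 x ≤ 2 • (P.1.1 y + Q.1.1 (x - y)) := by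
  have hP' : (0 : Lob E E) ≤ P.1 := hP
  have hQ' : (0 : Lob E E) ≤ Q.1 := hQ
  have hx : 0 ≤ x := hy.trans hyx
  -- The parts of `x` where `y` exceeds `x / 2` or falls short of it are separated by the disjoint
  -- elements `d⁺` and `d⁻`. Off `d⁻`, `x` is at most `2 • y`; off `d⁺`, it is at most `2 • (x -
  -- y)`.
  set d : E := 2 • y - x with hd
  have hu : d⁺ ≤ 2 • y := sup_le (sub_le_self _ hx) (nsmul_nonneg hy 2)
  have hux : d⁺ ≤ x := sup_le (by
    rw [hd, sub_le_iff_le_add, two_nsmul]; exact add_le_add hyx hyx) hx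
  have hvx : d⁻ ≤ x := by
    refine sup_le ?_ hx
    rw [hd, neg_sub]
    exact sub_le_self _ (nsmul_nonneg hy 2)
  have h1 : x - d⁻ ≤ 2 • y := by
    rw [sub_le_comm, ← neg_sub, ← hd]
    exact neg_le_negPart d
  have h2 : x - d⁺ ≤ 2 • (x - y) := by
    rw [sub_le_comm]
    have : x - 2 • (x - y) = d := by rw [hd, nsmul_sub, two_nsmul x]; abel
    rw [this]
    exact le_posPart d
  have hdisj : |P.1.1 d⁻| ⊓ |Q.1.1 d⁺| = 0 := by
    apply Orth.disjoint_apply_apply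
    rw [abs_of_nonneg (posPart_nonneg d), abs_of_nonneg (negPart_nonneg d), inf_comm]
    exact posPart_inf_negPart_eq_zero d
  have hPv : (0 : E) ≤ P.1.1 d⁻ := hP' _ (negPart_nonneg d)
  have hQu : (0 : E) ≤ Q.1.1 d⁺ := hQ' _ (posPart_nonneg d)
  rw [abs_of_nonneg hPv, abs_of_nonneg hQu] at hdisj
  set w := P.1.1 x ⊓ Q.1.1 x
  set p := P.1.1 (x - d⁻) with hp
  set q := Q.1.1 (x - d⁺) with hq
  have hp0 : 0 ≤ p := hP' _ (sub_nonneg.2 hvx)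
  have hq0 : 0 ≤ q := hQ' _ (sub_nonneg.2 hux)
  have hwp : w - p ≤ P.1.1 d⁻ := by
    rw [sub_le_comm]
    rw [hp, map_sub]
    exact sub_le_sub_right inf_le_left _
  have hwq : w - q ≤ Q.1.1 d⁺ := by
    rw [sub_le_comm]
    rw [hq, map_sub]
    exact sub_le_sub_right inf_le_right _
  -- This difference lies below both `P d⁻` and `Q d⁺`, whose infimum is 0.
  have h3 : w - (p + q) ≤ 0 := by
    rw [← hdisj]
    refine le_inf (le_trans ?_ hwp) (le_trans ?_ hwq)
    · exact sub_le_sub_left (le_add_of_nonneg_right hq0) _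
    · exact sub_le_sub_left (le_add_of_nonneg_left hp0) _
  refine (sub_nonpos.1 h3).trans ?_
  rw [nsmul_add, ← map_nsmul, ← map_nsmul]
  exact add_le_add (apply_le_apply_of_nonneg hP' h1) (apply_le_apply_of_nonneg hQ' h2)

/-- The positive part of an orthomorphism is calculated pointwise on the positive cone. -/
theorem Orth.exists_posPart_apply (T : Orth E) :
    ∃ P : Orth E, ∀ x, 0 ≤ x → P.1.1 x = (T.1.1 x)⁺ := by
  obtain ⟨P, hP, hf⟩ := exists_posPart_Lob T.1
  have hPO : P ∈ Orth E := mem_Orth_of_nonneg P fun B hB x hx h0 => by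
    refine hB.2 _ _ ?_ ((Set.nonempty_Icc.2 h0).image _) (hf x h0)
    rintro _ ⟨y, hy, rfl⟩
    refine T.2 B hB y (hB.1 y x ?_ hx)
    rw [abs_of_nonneg hy.1, abs_of_nonneg h0]
    exact hy.2
  have hP0 : (0 : Lob E E) ≤ P := hP.1 (Set.mem_insert_of_mem _ rfl)
  have hTP : T.1 ≤ P := hP.1 (Set.mem_insert _ _)
  have hQ0 : (0 : Orth E) ≤ ⟨P, hPO⟩ - T := sub_nonneg.2 hTP
  refine ⟨⟨P, hPO⟩, fun x hx => ?_⟩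
  have hQ : ∀ z, ((⟨P, hPO⟩ - T : Orth E) : Lob E E).1 z = P.1 z - T.1.1 z := fun _ => rfl
  -- With `Q = P - T`, one has `P (x - z) + Q z = P x - T z`. So half of `P x ⊓ Q x` can be
  -- subtracted from `P x` and still leave an upper bound of all `T z`, `0 ≤ z ≤ x`; by the
  -- Riesz–Kantorovich formula it is at most 0.
  have hw : P.1 x ⊓ (P.1 x - T.1.1 x) = 0 := by
    refine le_antisymm ?_ (le_inf (hP0 x hx) (sub_nonneg.2 (hTP x hx)))
    have hle : P.1 x ≤ P.1 x - (2⁻¹ : ℝ) • (P.1 x ⊓ (P.1 x - T.1.1 x)) := by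
      refine (hf x hx).2 ?_
      rintro _ ⟨z, hz, rfl⟩
      have h := Orth.inf_apply_le ⟨P, hPO⟩ (⟨P, hPO⟩ - T) hP0 hQ0 (sub_nonneg.2 hz.2)
        (sub_le_self x hz.1)
      rw [hQ, hQ, sub_sub_cancel] at h
      change P.1 x ⊓ (P.1 x - T.1.1 x) ≤ 2 • (P.1 (x - z) + (P.1 z - T.1.1 z)) at h
      rw [map_sub, sub_add_sub_cancel, ← Nat.cast_smul_eq_nsmul ℝ] at h
      have h' := smul_le_smul_of_nonneg_left h (by norm_num : (0 : ℝ) ≤ 2⁻¹)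
      rw [Nat.cast_ofNat, inv_smul_smul₀ two_ne_zero] at h'
      exact le_sub_comm.1 h'
    have h := smul_le_smul_of_nonneg_left ((le_sub_self_iff _).1 hle)
      (by norm_num : (0 : ℝ) ≤ 2)
    rwa [smul_inv_smul₀ two_ne_zero, smul_zero] at h
  -- Disjointness turns the supremum of `P x` and `P x - T x` into their sum; translating by `T x -
  -- P x` gives `T x ⊔ 0 = P x`.
  have h := inf_add_sup (P.1 x) (P.1 x - T.1.1 x)
  rw [hw, zero_add] at h
  have h' : P.1 x ⊔ (P.1 x - T.1.1 x) = P.1 x + P.1 x - T.1.1 x := by rw [h]; abel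
  change P.1 x = T.1.1 x ⊔ 0
  have h2 : T.1.1 x ⊔ 0 = (P.1 x ⊔ (P.1 x - T.1.1 x)) + (T.1.1 x - P.1 x) := by
    rw [sup_add]
    congr 1 <;> abel
  rw [h2, h']
  abel

/-- The modulus of an orthomorphism, in the orthomorphisms as well as in the order bounded
operators, is calculated pointwise on the positive cone. -/
theorem Orth.exists_abs_apply (T : Orth E) :
    ∃ A : Orth E, A = |T| ∧ A.1 = |T.1| ∧ ∀ x, 0 ≤ x → A.1.1 x = |T.1.1 x| := by
  obtain ⟨P, hP⟩ := Orth.exists_posPart_apply T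
  -- `2 • P - T` is `T⁺ + T⁻`, since `T⁻ = P - T`.
  have hA : ∀ x, 0 ≤ x → (2 • P - T).1.1 x = |T.1.1 x| := fun x hx => by
    have : (2 • P - T).1.1 x = 2 • P.1.1 x - T.1.1 x := rfl
    rw [this, hP x hx, ← posPart_add_negPart (T.1.1 x)]
    rw [two_nsmul, add_sub_assoc]
    congr 1
    rw [sub_eq_iff_eq_add', ← sub_eq_iff_eq_add, posPart_sub_negPart]
  have h1 : T.1 ≤ (2 • P - T).1 := fun x hx => (le_abs_self _).trans (hA x hx).ge
  have h2 : -T.1 ≤ (2 • P - T).1 := fun x hx => (neg_le_abs _).trans (hA x hx).ge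
  have h3 : ∀ R : Lob E E, T.1 ≤ R → -T.1 ≤ R → (2 • P - T).1 ≤ R := fun R hR hR' x hx =>
    (hA x hx).le.trans (abs_le'.2 ⟨hR x hx, hR' x hx⟩)
  refine ⟨2 • P - T, le_antisymm ?_ (abs_le'.2 ⟨h1, h2⟩),
    le_antisymm (h3 _ (le_abs_self _) (neg_le_abs _)) (abs_le'.2 ⟨h1, h2⟩), hA⟩
  exact h3 |T|.1 (le_abs_self T) (neg_le_abs T)

/-- The pointwise modulus is least among the upper bounds of `T` and `-T` in either space, so the
two lattice structures give the same modulus. -/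
theorem Orth.coe_abs (T : Orth E) : |T|.1 = |T.1| := by
  obtain ⟨A, h1, h2, -⟩ := Orth.exists_abs_apply T
  rw [← h1, h2]

theorem Orth.abs_apply (T : Orth E) {x : E} (hx : 0 ≤ x) : |T|.1.1 x = |T.1.1 x| := by
  obtain ⟨A, h1, -, h⟩ := Orth.exists_abs_apply T
  rw [← h1, h x hx]

theorem Orth.abs_apply_le (T : Orth E) (x : E) : |T.1.1 x| ≤ |T|.1.1 |x| := by
  rw [← posPart_add_negPart x, map_add, Orth.abs_apply T (posPart_nonneg x),
    Orth.abs_apply T (negPart_nonneg x)]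
  conv_lhs => rw [← posPart_sub_negPart x, map_sub]
  rw [sub_eq_add_neg, ← abs_neg (T.1.1 x⁻)]
  exact abs_add_le _ _

/-- `T x⁺` and `T x⁻` are disjoint, so each is dominated in modulus by their difference `T x`. The
factor 2 is not sharp but is harmless for convergence to 0. -/
theorem Orth.abs_apply_abs_le (T : Orth E) (x : E) : |T|.1.1 |x| ≤ 2 • |T.1.1 x| := by
  have h : |T.1.1 x⁺| ⊓ |T.1.1 x⁻| = 0 := by
    apply Orth.disjoint_apply_apply
    rw [abs_of_nonneg (posPart_nonneg x), abs_of_nonneg (negPart_nonneg x)]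
    exact posPart_inf_negPart_eq_zero x
  have hx : T.1.1 x = T.1.1 x⁺ - T.1.1 x⁻ := by rw [← map_sub, posPart_sub_negPart]
  rw [← posPart_add_negPart x, map_add, Orth.abs_apply T (posPart_nonneg x),
    Orth.abs_apply T (negPart_nonneg x), two_nsmul, hx]
  refine add_le_add (abs_le_abs_sub_of_inf_eq_zero h) ?_
  rw [abs_sub_comm]
  rw [inf_comm] at h
  exact abs_le_abs_sub_of_inf_eq_zero h

end Modulus

/-! ### Pointwise suprema and infima of operators -/

section PointwiseSup

variable {E : Type*} [AddCommGroup E] [ConditionallyCompleteLattice E] [IsOrderedAddMonoid E]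
  [Module ℝ E] [IsOrderedModule ℝ E]

/-- A family of order bounded operators that is pointwise bounded above on the positive cone has
a pointwise supremum, as soon as these suprema are superadditive. -/
theorem exists_pointwise_sup {ι : Type*} [Nonempty ι] (f : ι → Lob E E)
    (hbdd : ∀ x, 0 ≤ x → BddAbove (Set.range fun i => (f i).1 x))
    (hsup : ∀ i j x y c, 0 ≤ x → 0 ≤ y → (∀ k, (f k).1 (x + y) ≤ c) →
      (f i).1 x + (f j).1 y ≤ c) :
    ∃ P : Lob E E, ∀ x, 0 ≤ x → IsLUB (Set.range fun i => (f i).1 x) (P.1 x) := by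
  have hle : ∀ i x, 0 ≤ x → (f i).1 x ≤ ⨆ i, (f i).1 x := fun i x hx => le_ciSup (hbdd x hx) i
  obtain ⟨P, hP⟩ := exists_linear_extension (fun x => ⨆ i, (f i).1 x) (by
      intro x y hx hy
      apply le_antisymm
      · refine ciSup_le fun i => ?_
        rw [map_add]
        exact add_le_add (hle i x hx) (hle i y hy)
      · rw [← le_sub_iff_add_le]
        refine ciSup_le fun i => ?_
        rw [le_sub_comm]
        refine ciSup_le fun j => ?_
        rw [le_sub_iff_add_le']
        exact hsup i j x y _ hx hy fun k => hle k _ (add_nonneg hx hy)) (by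
      intro c x hc hx
      apply le_antisymm
      · refine ciSup_le fun i => ?_
        rw [map_smul]
        exact smul_le_smul_of_nonneg_left (hle i x hx) hc.le
      · have h : (⨆ i, (f i).1 x) ≤ c⁻¹ • ⨆ i, (f i).1 (c • x) := by
          refine ciSup_le fun i => ?_
          have := smul_le_smul_of_nonneg_left (hle i _ (smul_nonneg hc.le hx)) (inv_pos.2 hc).le
          rwa [map_smul, inv_smul_smul₀ hc.ne'] at this
        have := smul_le_smul_of_nonneg_left h hc.le
        rwa [smul_inv_smul₀ hc.ne'] at this)
  have hlub : ∀ x, 0 ≤ x → IsLUB (Set.range fun i => (f i).1 x) (P x) := fun x hx => by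
    rw [hP x hx]
    exact isLUB_ciSup (hbdd x hx)
  obtain ⟨i⟩ := ‹Nonempty ι›
  -- `P` itself need not be positive, but it differs from an order bounded operator by a positive
  -- one.
  have hPi : P - (f i).1 ∈ Lob E E := mem_Lob_of_nonneg _ fun x hx => by
    rw [LinearMap.sub_apply, sub_nonneg]
    exact (hlub x hx).1 ⟨i, rfl⟩
  have hPL : P ∈ Lob E E := by
    have := (Lob E E).add_mem hPi (f i).2
    rwa [sub_add_cancel] at this
  exact ⟨⟨P, hPL⟩, hlub⟩

/-- The infimum of a decreasing net of order bounded operators is a pointwise infimum. -/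
theorem isGLB_apply {B : Type*} [Preorder B] [IsDirectedOrder B] [Nonempty B] {Y : B → Lob E E}
    (hY : Antitone Y) (hglb : IsGLB (Set.range Y) 0) {x : E} (hx : 0 ≤ x) :
    IsGLB (Set.range fun b => (Y b).1 x) 0 := by
  have h0 : ∀ b, 0 ≤ Y b := fun b => hglb.1 ⟨b, rfl⟩
  obtain ⟨P, hP⟩ := exists_pointwise_sup (fun b => -Y b) (by
      intro x hx
      refine ⟨0, ?_⟩
      rintro _ ⟨b, rfl⟩
      exact neg_nonpos.2 (h0 b x hx)) (by
      intro i j x y c hx hy hc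
      -- Superadditivity comes from directedness: a common later index dominates both terms.
      obtain ⟨k, hik, hjk⟩ := exists_ge_ge i j
      refine le_trans ?_ (hc k)
      rw [map_add]
      exact add_le_add (neg_le_neg (hY hik x hx)) (neg_le_neg (hY hjk y hy)))
  have hP0 : -P ≤ 0 := hglb.2 (by
    rintro _ ⟨b, rfl⟩ z hz
    exact neg_le.1 ((hP z hz).1 ⟨b, rfl⟩))
  refine ⟨?_, fun c hc => ?_⟩
  · rintro _ ⟨b, rfl⟩
    exact h0 b x hx
  · have h1 : P.1 x ≤ -c := (hP x hx).2 (by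
      rintro _ ⟨b, rfl⟩
      exact neg_le_neg (hc ⟨b, rfl⟩))
    have h2 : -P.1 x ≤ 0 := hP0 x hx
    exact (le_neg.1 h1).trans h2

end PointwiseSup

/-! ### Sequences that are order convergent to zero -/

section NullSequences

variable {X : Type u} [AddCommGroup X] [Lattice X] [IsOrderedAddMonoid X]

omit [IsOrderedAddMonoid X] in
theorem orderTendsto_zero_iff {a : ℕ → X} :
    OrderTendsto a 0 ↔ ∃ (B : Type u) (_ : Preorder B) (_ : IsDirectedOrder B) (_ : Nonempty B)
      (y : B → X), Antitone y ∧ IsGLB (Set.range y) 0 ∧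
        ∀ b₀ : B, ∃ n₀ : ℕ, ∀ n : ℕ, n₀ ≤ n → |a n| ≤ y b₀ := by
  simp only [OrderTendsto, zero_sub, abs_neg]

omit [IsOrderedAddMonoid X] in
theorem OrderTendsto.of_abs_le {a b : ℕ → X} (h : OrderTendsto a 0)
    (hab : ∀ n, |b n| ≤ |a n|) : OrderTendsto b 0 := by
  obtain ⟨B, i₁, i₂, i₃, y, hy, hglb, h⟩ := orderTendsto_zero_iff.1 h
  refine orderTendsto_zero_iff.2 ⟨B, i₁, i₂, i₃, y, hy, hglb, fun b₀ => ?_⟩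
  obtain ⟨n₀, hn₀⟩ := h b₀
  refine ⟨n₀, fun n hn => ?_⟩
  have := hn₀ n hn
  exact (hab n).trans this

theorem OrderTendsto.add_zero {a b : ℕ → X} (ha : OrderTendsto a 0) (hb : OrderTendsto b 0) :
    OrderTendsto (fun n => a n + b n) 0 := by
  obtain ⟨B, i₁, i₂, i₃, y, hy, hyg, ha⟩ := orderTendsto_zero_iff.1 ha
  obtain ⟨C, j₁, j₂, j₃, z, hz, hzg, hb⟩ := orderTendsto_zero_iff.1 hb
  refine orderTendsto_zero_iff.2 ⟨B × C, inferInstance, ⟨fun p q => ?_⟩, inferInstance, fun p => y p.1 + z p.2,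
    fun p q hpq => add_le_add (hy hpq.1) (hz hpq.2), ⟨?_, fun c hc => ?_⟩, ?_⟩
  · obtain ⟨r, hr⟩ := directed_of (· ≤ ·) p.1 q.1
    obtain ⟨t, ht⟩ := directed_of (· ≤ ·) p.2 q.2
    exact ⟨(r, t), ⟨hr.1, ht.1⟩, ⟨hr.2, ht.2⟩⟩
  · rintro _ ⟨p, rfl⟩
    exact add_nonneg (hyg.1 ⟨_, rfl⟩) (hzg.1 ⟨_, rfl⟩)
  · refine hzg.2 ?_
    rintro _ ⟨k, rfl⟩
    rw [← sub_nonpos]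
    refine hyg.2 ?_
    rintro _ ⟨b, rfl⟩
    exact sub_le_iff_le_add.2 (hc ⟨(b, k), rfl⟩)
  · rintro ⟨b₀, c₀⟩
    obtain ⟨m, hm⟩ := ha b₀
    obtain ⟨n, hn⟩ := hb c₀
    refine ⟨m ⊔ n, fun k hk => ?_⟩
    have h1 := hm k (le_sup_left.trans hk)
    have h2 := hn k (le_sup_right.trans hk)
    exact (abs_add_le _ _).trans (add_le_add h1 h2)

theorem orderTendsto_const_zero : OrderTendsto (fun _ : ℕ => (0 : X)) 0 :=
  ⟨PUnit, inferInstance, inferInstance, inferInstance, fun _ => 0, fun _ _ _ => le_rfl,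
    by rw [Set.range_const]; exact isGLB_singleton, fun _ => ⟨0, fun _ _ => by simp⟩⟩

theorem OrderTendsto.nsmul_zero {a : ℕ → X} (ha : OrderTendsto a 0) (k : ℕ) :
    OrderTendsto (fun n => k • a n) 0 := by
  induction k with
  | zero => simpa only [zero_nsmul] using orderTendsto_const_zero
  | succ k ih => simpa only [succ_nsmul] using ih.add_zero ha

theorem OrderTendsto.abs_zero {a : ℕ → X} (ha : OrderTendsto a 0) :
    OrderTendsto (fun n => |a n|) 0 :=
  ha.of_abs_le fun n => (abs_abs (a n)).le

omit [IsOrderedAddMonoid X] in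
-- A tail is bounded by a member of the dominating net, and only finitely many terms precede it. The
-- latter fails for general nets; this is where sequences matter.
theorem OrderTendsto.bddAbove {a : ℕ → X} (h : OrderTendsto a 0) :
    BddAbove (Set.range fun n => |a n|) := by
  obtain ⟨B, i₁, i₂, ⟨b₀⟩, y, hy, hyg, h⟩ := orderTendsto_zero_iff.1 h
  obtain ⟨n₀, hn₀⟩ := h b₀
  have h1 : BddAbove ((fun n => |a n|) '' Set.Iio n₀) := ((Set.finite_Iio n₀).image _).bddAbove
  have h2 : BddAbove ((fun n => |a n|) '' Set.Ici n₀) := by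
    refine ⟨y b₀, ?_⟩
    rintro _ ⟨n, hn, rfl⟩
    exact hn₀ n hn
  rw [← Set.image_univ, ← Set.Iio_union_Ici (a := n₀), Set.image_union]
  exact h1.union h2

end NullSequences

/-! ### The implications between the modes of convergence -/

section Orthomorphisms

variable {E : Type*} [AddCommGroup E] [ConditionallyCompleteLattice E] [IsOrderedAddMonoid E]
  [Module ℝ E] [IsOrderedModule ℝ E]

theorem Orth.orderTendsto_coe {T : ℕ → Orth E} (h : OrderTendsto T 0) :
    OrderTendsto (fun n => (T n).1) 0 := by
  obtain ⟨B, i₁, i₂, i₃, Y, hY, hYg, h⟩ := orderTendsto_zero_iff.1 h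
  have hY0 : ∀ b, 0 ≤ (Y b).1 := fun b => hYg.1 ⟨b, rfl⟩
  refine orderTendsto_zero_iff.2 ⟨B, i₁, i₂, i₃, fun b => (Y b).1, fun b c hbc => hY hbc, ⟨?_, fun R hR => ?_⟩, ?_⟩
  · rintro _ ⟨b, rfl⟩
    exact hY0 b
  -- A lower bound `R` in `Lob E E` need not be an orthomorphism, but `R⁺` is one, as it lies
  -- between 0 and `Y b₀`; so it can be tested against the infimum in `Orth E`.
  · have hR0 : (0 : Lob E E) ≤ R⁺ := posPart_nonneg R
    have hRY : ∀ b, R⁺ ≤ (Y b).1 := fun b => sup_le (hR ⟨b, rfl⟩) (hY0 b)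
    obtain ⟨b₀⟩ := i₃
    have hRO : R⁺ ∈ Orth E := mem_Orth_of_abs_le _ (Y b₀) fun x hx => by
      have h1 : (0 : E) ≤ (R⁺).1 x := hR0 x hx
      rw [abs_of_nonneg h1]
      exact (hRY b₀ x hx).trans (le_abs_self _)
    have h2 : (⟨R⁺, hRO⟩ : Orth E) ≤ 0 := hYg.2 (by
      rintro _ ⟨b, rfl⟩
      exact hRY b)
    exact (le_posPart R).trans h2
  · intro b₀
    obtain ⟨n₀, hn₀⟩ := h b₀
    refine ⟨n₀, fun n hn => ?_⟩
    have := hn₀ n hn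
    rw [← Orth.coe_abs]
    exact this

theorem Orth.orderTendsto_apply_of_coe {T : ℕ → Orth E}
    (h : OrderTendsto (fun n => (T n).1) 0) (x : E) :
    OrderTendsto (fun n => (T n).1.1 x) 0 := by
  obtain ⟨B, i₁, i₂, i₃, Y, hY, hYg, h⟩ := orderTendsto_zero_iff.1 h
  refine orderTendsto_zero_iff.2 ⟨B, i₁, i₂, i₃, fun b => (Y b).1 |x|, fun b c hbc => hY hbc _ (abs_nonneg x),
    isGLB_apply hY hYg (abs_nonneg x), fun b₀ => ?_⟩
  obtain ⟨n₀, hn₀⟩ := h b₀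
  refine ⟨n₀, fun n hn => ?_⟩
  have := hn₀ n hn
  rw [← Orth.coe_abs] at this
  exact (Orth.abs_apply_le _ _).trans (this _ (abs_nonneg x))

/-- The elements `x` for which `|T n| |x|` is order convergent to zero. -/
def nullSubmodule (T : ℕ → Orth E) : Submodule ℝ E where
  carrier := {x | OrderTendsto (fun n => |T n|.1.1 |x|) 0}
  zero_mem' := by simpa using orderTendsto_const_zero (X := E)
  add_mem' := by
    intro x y hx hy
    refine (OrderTendsto.add_zero hx hy).of_abs_le fun n => ?_
    have h0 : (0 : Lob E E) ≤ |T n|.1 := abs_nonneg (T n)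
    have h1 : (0 : E) ≤ |T n|.1.1 |x + y| := h0 _ (abs_nonneg _)
    rw [← map_add, abs_of_nonneg h1]
    exact (apply_le_apply_of_nonneg h0 (abs_add_le x y)).trans (le_abs_self _)
  smul_mem' := by
    intro c x hx
    obtain ⟨k, hk⟩ := exists_nat_ge |c|
    refine (OrderTendsto.nsmul_zero hx k).of_abs_le fun n => ?_
    have h0 : (0 : Lob E E) ≤ |T n|.1 := abs_nonneg (T n)
    have h1 : (0 : E) ≤ |T n|.1.1 |c • x| := h0 _ (abs_nonneg _)
    rw [← map_nsmul, abs_of_nonneg h1]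
    exact (apply_le_apply_of_nonneg h0 (abs_smul_le_nsmul hk x)).trans (le_abs_self _)

/-- Follows from `|T x| ≤ |T| |x| ≤ 2 • |T x|`. The form with `|T n|` and `|x|` is the one for which
the ideal property is immediate from positivity of `|T n|`. -/
theorem mem_nullSubmodule {T : ℕ → Orth E} {x : E} :
    x ∈ nullSubmodule T ↔ OrderTendsto (fun n => (T n).1.1 x) 0 := by
  constructor
  · intro h
    exact OrderTendsto.of_abs_le h fun n => (Orth.abs_apply_le _ _).trans (le_abs_self _)
  · intro h
    refine (h.abs_zero.nsmul_zero 2).of_abs_le fun n => ?_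
    have h0 : (0 : Lob E E) ≤ |T n|.1 := abs_nonneg (T n)
    have h1 : (0 : E) ≤ |T n|.1.1 |x| := h0 _ (abs_nonneg _)
    rw [abs_of_nonneg h1]
    exact (Orth.abs_apply_abs_le _ _).trans (le_abs_self _)

theorem isIdeal_nullSubmodule (T : ℕ → Orth E) : IsIdeal (nullSubmodule T) := by
  intro x y hxy hy
  refine OrderTendsto.of_abs_le hy fun n => ?_
  have h0 : (0 : Lob E E) ≤ |T n|.1 := abs_nonneg (T n)
  have h1 : (0 : E) ≤ |T n|.1.1 |x| := h0 _ (abs_nonneg _)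
  rw [abs_of_nonneg h1]
  exact (apply_le_apply_of_nonneg h0 hxy).trans (le_abs_self _)

theorem Orth.orderTendsto_apply_of_idealSpan {T : ℕ → Orth E} {S : Set E}
    (hS : idealSpan S = ⊤) (h : ∀ s ∈ S, OrderTendsto (fun n => (T n).1.1 s) 0) (x : E) :
    OrderTendsto (fun n => (T n).1.1 x) 0 := by
  have hle : idealSpan S ≤ nullSubmodule T :=
    sInf_le ⟨isIdeal_nullSubmodule T, fun s hs => mem_nullSubmodule.2 (h s hs)⟩
  rw [hS] at hle
  exact mem_nullSubmodule.1 (hle Submodule.mem_top)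

/-- The tails of a pointwise bounded sequence of orthomorphisms have pointwise suprema of the
moduli, which are orthomorphisms. -/
theorem Orth.exists_tail_sup {T : ℕ → Orth E}
    (h : ∀ x, BddAbove (Set.range fun n => |(T n).1.1 x|)) (m : ℕ) :
    ∃ Y : Orth E, ∀ x, 0 ≤ x →
      IsLUB (Set.range fun n : Set.Ici m => |(T n).1.1 x|) (Y.1.1 x) := by
  have heq : ∀ x, 0 ≤ x → (fun n : Set.Ici m => |T n|.1.1 x) = fun n : Set.Ici m => |(T n).1.1 x| :=
    fun x hx => funext fun n => Orth.abs_apply _ hx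
  obtain ⟨Y, hY⟩ := exists_pointwise_sup (fun n : Set.Ici m => |T n|.1) (by
      intro x hx
      rw [heq x hx]
      refine (h x).mono ?_
      rintro _ ⟨n, rfl⟩
      exact ⟨n, rfl⟩) (by
      intro i j x y c hx hy hc
      -- `|T j| + (|T i| - |T j|)⁺` is a linear operator that takes the value `|T i| z ⊔ |T j| z` at
      -- each `z ≥ 0`. Its additivity replaces the directedness that the family of moduli lacks.
      obtain ⟨P, hP⟩ := Orth.exists_posPart_apply (|T i| - |T j|)
      have hP' : ∀ z, 0 ≤ z → |T j|.1.1 z + P.1.1 z = |T i|.1.1 z ⊔ |T j|.1.1 z := fun z hz => by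
        have h : (|T i| - |T j|).1.1 z = |T i|.1.1 z - |T j|.1.1 z := rfl
        rw [hP z hz, h, posPart_def, add_sup, add_sub_cancel, add_zero]
      calc |T i|.1.1 x + |T j|.1.1 y
          ≤ (|T j|.1.1 x + P.1.1 x) + (|T j|.1.1 y + P.1.1 y) := by
            rw [hP' x hx, hP' y hy]
            exact add_le_add le_sup_left le_sup_right
        _ = |T j|.1.1 (x + y) + P.1.1 (x + y) := by
            rw [map_add, map_add, add_add_add_comm]
        _ ≤ c := by
            rw [hP' _ (add_nonneg hx hy)]
            exact sup_le (hc i) (hc j))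
  have hYO : Y ∈ Orth E := mem_Orth_of_nonneg Y fun B hB x hx hx0 => by
    refine hB.2 _ _ ?_ (Set.range_nonempty _) (hY x hx0)
    rintro _ ⟨n, rfl⟩
    exact |T n|.2 B hB x hx
  refine ⟨⟨Y, hYO⟩, fun x hx => ?_⟩
  rw [← heq x hx]
  exact hY x hx

theorem Orth.orderTendsto_of_apply {T : ℕ → Orth E}
    (h : ∀ x, OrderTendsto (fun n => (T n).1.1 x) 0) : OrderTendsto T 0 := by
  choose Y hY using Orth.exists_tail_sup fun x => (h x).bddAbove
  have hle : ∀ m n, m ≤ n → ∀ x, 0 ≤ x → |(T n).1.1 x| ≤ (Y m).1.1 x := fun m n hmn x hx =>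
    (hY m x hx).1 ⟨⟨n, hmn⟩, rfl⟩
  -- The dominating net is the sequence of tail suprema; `ULift` only moves its index set to the
  -- universe of `E`.
  refine orderTendsto_zero_iff.2 ⟨ULift ℕ, inferInstance, inferInstance, inferInstance, fun m => Y m.down, ?_,
    ⟨?_, fun R hR x hx => ?_⟩, fun m => ⟨m.down, fun n hn => ?_⟩⟩
  · intro m k hmk x hx
    refine (hY k.down x hx).2 ?_
    rintro _ ⟨n, rfl⟩
    exact hle _ _ (le_trans hmk n.2) x hx
  · rintro _ ⟨m, rfl⟩ x hx
    exact (abs_nonneg _).trans (hle m.down m.down le_rfl x hx)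
  -- At a fixed `x ≥ 0`, each `y b` bounds a whole tail of `|T n x|`, hence some `Y n₀ x`, hence `R
  -- x`.
  · obtain ⟨B, i₁, i₂, i₃, y, hy, hyg, h⟩ := orderTendsto_zero_iff.1 (h x)
    refine hyg.2 ?_
    rintro _ ⟨b, rfl⟩
    obtain ⟨n₀, hn₀⟩ := h b
    refine le_trans (hR ⟨⟨n₀⟩, rfl⟩ x hx) ((hY n₀ x hx).2 ?_)
    rintro _ ⟨n, rfl⟩
    exact hn₀ n n.2
  · intro x hx
    rw [Orth.abs_apply _ hx]
    exact hle _ _ hn x hx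

omit [IsOrderedAddMonoid E] [IsOrderedModule ℝ E] in
theorem IsStrongOrderUnit.idealSpan_eq_top {e : E} (he : IsStrongOrderUnit e) :
    idealSpan {e} = ⊤ := by
  refine top_unique (le_sInf ?_)
  rintro I ⟨hI, heI⟩ x -
  obtain ⟨c, hc, hx⟩ := he.2 x
  exact hI x (c • e) (hx.trans (le_abs_self _)) (I.smul_mem c (heI rfl))

end Orthomorphisms

end VectorLattice

/-! ### The equivalence and the case of a strong order unit -/

theorem mainTheorem5 {E : Type*} [AddCommGroup E] [ConditionallyCompleteLattice E]
    [IsOrderedAddMonoid E] [Module ℝ E] [IsOrderedModule ℝ E]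
    (T : ℕ → VectorLattice.Orth E) :
    (∀ S : Set E, S.Nonempty → VectorLattice.idealSpan S = ⊤ →
      List.TFAE [
        VectorLattice.OrderTendsto T 0,
        VectorLattice.OrderTendsto (fun n => (T n : VectorLattice.Lob E E)) 0,
        ∀ s ∈ S, VectorLattice.OrderTendsto (fun n => (T n : VectorLattice.Lob E E).1 s) 0,
        ∀ x : E, VectorLattice.OrderTendsto (fun n => (T n : VectorLattice.Lob E E).1 x) 0]) ∧
    (∀ e : E, VectorLattice.IsStrongOrderUnit e →
      (VectorLattice.OrderTendsto T 0 ↔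
        VectorLattice.OrderTendsto (fun n => (T n : VectorLattice.Lob E E).1 e) 0)) := by
  have key : ∀ S : Set E, S.Nonempty → VectorLattice.idealSpan S = ⊤ →
      List.TFAE [
        VectorLattice.OrderTendsto T 0,
        VectorLattice.OrderTendsto (fun n => (T n : VectorLattice.Lob E E)) 0,
        ∀ s ∈ S, VectorLattice.OrderTendsto (fun n => (T n : VectorLattice.Lob E E).1 s) 0,
        ∀ x : E, VectorLattice.OrderTendsto (fun n => (T n : VectorLattice.Lob E E).1 x) 0] := by
    intro S _ hS
    tfae_have 1 → 2 := VectorLattice.Orth.orderTendsto_coe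
    tfae_have 2 → 3 := fun h s _ => VectorLattice.Orth.orderTendsto_apply_of_coe h s
    tfae_have 3 → 4 := VectorLattice.Orth.orderTendsto_apply_of_idealSpan hS
    tfae_have 4 → 1 := VectorLattice.Orth.orderTendsto_of_apply
    tfae_finish
  refine ⟨key, fun e he => ?_⟩
  have h := (key {e} (Set.singleton_nonempty e) he.idealSpan_eq_top).out 0 2
  simpa only [Set.mem_singleton_iff, forall_eq] using h
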